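/- **Setting.** Let $D$ be a set of data sets with a relation "neighboring". A function $f:D\to\mathbb{R}$ is called $1$-Lipschitz if $|f(X)-f(X')|\le 1$ for all neighboring $X,X'\in D$. Write $\mathrm{Lap}(b)$ for the centred Laplace distribution with density $\frac{1}{2b}e^{-|x|/b}$. **Algorithm (Private Guess-and-Check).** Input: a private data set $X\in D$, an error tolerance $E>0$, an integer $c\ge 1$ and a real $\varepsilon\in(0,1)$. The algorithm draws $\rho\sim\mathrm{Lap}(1/\varepsilon)$ once and sets $t=0$. For $i=1,2,\dots$ it receives a query $(f_i,\tau_i)$, where $f_i:D\to\mathbb{R}$ is $1$-Lipschitz and $\tau_i\in\mathbb{R}$, and draws a fresh $\gamma_i\sim\mathrm{Lap}(c/\varepsilon)$. * If $|f_i(X)-\tau_i|+\gamma_i\ge E+\rho$, it reports $(\mathrm{WRONG},v_i)$, where $v_i=f_i(X)+\eta_i$ with a fresh $\eta_i\sim\mathrm{Lap}(c/\varepsilon)$, increases $t$ by $1$, and halts if $t=c$. * Otherwise it reports $\mathrm{PASS}$. All noises are independent. After halting, every further query is answered by a fixed symbol $\mathrm{HALTED}$. **Privacy.** An adversary is a (possibly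 randomized, measurable) rule that chooses the next query from the history of all previous queries and responses. For an adversary $\mathcal{A}$ and an interactive mechanism $\mathcal{M}$ run on the data set $X$, let $\mathbf{IT}_T(\mathcal{A}:\mathcal{M}^X)$ be the random transcript (queries and responses) of the first $T$ rounds of their interaction. The mechanism $\mathcal{M}$ is $(\varepsilon,\delta)$-DP if for all neighboring $X,X'$, every adversary $\mathcal{A}$, every $T$ and every measurable set $S$ of $T$-round transcripts, $$\Pr[\mathbf{IT}_T(\mathcal{A}:\mathcal{M}^{X})\in S]\le e^{\varepsilon}\Pr[\mathbf{IT}_T(\mathcal{A}:\mathcal{M}^{X'})\in S]+\delta,$$ and the same holds with $X$ and $X'$ exchanged. **Theorem.** For every $E>0$, every integer $c\ge 1$ and every $\varepsilon\in(0,1)$, the Private Guess-and-Check algorithm with parameters $E,c,\varepsilon$ is $(4\varepsilon,0)$-DP. -/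

import Mathlib

open MeasureTheory ProbabilityTheory

/-! ### The Laplace distribution -/

/-- The density of the centred Laplace distribution with scale `b`. -/
noncomputable def laplacePDF (b x : ℝ) : ENNReal :=
  ENNReal.ofReal (1 / (2 * b) * Real.exp (-|x| / b))

/-- The centred Laplace distribution `Lap(b)` with scale `b > 0`. By convention it is the point
mass at `0` when `b ≤ 0`. -/
noncomputable def laplace (b : ℝ) : Measure ℝ :=
  open Classical in
  if 0 < b then volume.withDensity (laplacePDF b) else Measure.dirac 0

theorem lintegral_laplacePDF {b : ℝ} (hb : 0 < b) : ∫⁻ x, laplacePDF b x = 1 := by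
  have hb' : -b⁻¹ < 0 := by simpa using hb
  have hval : ∫ x : ℝ, 1 / (2 * b) * Real.exp (-|x| / b) = 1 := by
    rw [integral_comp_abs (f := fun x : ℝ => 1 / (2 * b) * Real.exp (-x / b)),
      integral_const_mul]
    have : ∫ x in Set.Ioi (0 : ℝ), Real.exp (-x / b) = b := by
      have h := integral_exp_mul_Ioi hb' 0
      have e : (fun x : ℝ => Real.exp (-x / b)) = fun x => Real.exp (-b⁻¹ * x) := by
        funext x
        congr 1
        ring
      rw [e, h]
      simp
    rw [this]
    field_simp
  have hint : Integrable (fun x : ℝ => 1 / (2 * b) * Real.exp (-|x| / b)) := by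
    by_contra h
    rw [integral_undef h] at hval
    exact zero_ne_one hval
  unfold laplacePDF
  rw [← ofReal_integral_eq_lintegral_ofReal hint
    (Filter.Eventually.of_forall fun x => by positivity), hval, ENNReal.ofReal_one]

instance isProbabilityMeasure_laplace (b : ℝ) : IsProbabilityMeasure (laplace b) := by
  unfold laplace
  split_ifs with hb
  · refine ⟨?_⟩
    rw [withDensity_apply _ MeasurableSet.univ, Measure.restrict_univ, lintegral_laplacePDF hb]
  · infer_instance

/-! ### Interactive systems, adversaries and differential privacy -/

/-- An interactive system with queries in `Q` and responses in `Y`: a randomized algorithm with an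
internal memory. It draws its initial memory from `start`; asked the query `q` while its memory is
`s`, it draws its new memory and its response from `step (s, q)`. -/
structure InteractiveSystem (Q Y : Type*) [MeasurableSpace Q] [MeasurableSpace Y] where
  State : Type
  [measurableSpaceState : MeasurableSpace State]
  start : Measure State
  [isProbabilityMeasure_start : IsProbabilityMeasure start]
  step : Kernel (State × Q) (State × Y)
  [isMarkovKernel_step : IsMarkovKernel step]

attribute [instance] InteractiveSystem.measurableSpaceState
  InteractiveSystem.isProbabilityMeasure_start InteractiveSystem.isMarkovKernel_step

/-- An adversary: a randomized rule that chooses the next query from the list of all past queries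
and responses. -/
structure Adversary (Q Y : Type*) [MeasurableSpace Q] [MeasurableSpace Y] where
  next : (t : ℕ) → Kernel (Fin t → Q × Y) Q
  [isMarkovKernel_next : ∀ t, IsMarkovKernel (next t)]

attribute [instance] Adversary.isMarkovKernel_next

section Transcript

variable {Q Y : Type*} [MeasurableSpace Q] [MeasurableSpace Y]

/-- The joint law of the transcript of the first `t` rounds of interaction between the adversary
`A` and the system `M`, and of the memory of `M` after these rounds. In a round, `A` sends a query
drawn from its rule applied to the transcript so far, and `M` then makes one step. -/
noncomputable def transcriptStateLaw (A : Adversary Q Y) (M : InteractiveSystem Q Y) :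
    (t : ℕ) → Measure ((Fin t → Q × Y) × M.State)
  | 0 => M.start.map fun s => (Fin.elim0, s)
  | t + 1 =>
    ((transcriptStateLaw A M t ⊗ₘ (A.next t).comap Prod.fst measurable_fst) ⊗ₘ
      M.step.comap (fun p : ((Fin t → Q × Y) × M.State) × Q => (p.1.2, p.2))
        (measurable_fst.snd.prodMk measurable_snd)).map
      fun p => (Fin.snoc (α := fun _ => Q × Y) p.1.1.1 (p.1.2, p.2.2), p.2.1)

/-- The law of the transcript of the first `T` rounds of interaction between the adversary `A` and
the system `M`. -/
noncomputable def transcriptLaw (A : Adversary Q Y) (M : InteractiveSystem Q Y) (T : ℕ) :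
    Measure (Fin T → Q × Y) :=
  (transcriptStateLaw A M T).map Prod.fst

theorem measurable_snoc (t : ℕ) :
    Measurable fun p : (Fin t → Q × Y) × (Q × Y) =>
      (Fin.snoc (α := fun _ => Q × Y) p.1 p.2 : Fin (t + 1) → Q × Y) := by
  refine measurable_pi_lambda _ fun i => ?_
  refine Fin.lastCases ?_ (fun j => ?_) i
  · simpa using measurable_snd
  · simp only [Fin.snoc_castSucc]
    exact (measurable_pi_apply j).comp measurable_fst

instance isProbabilityMeasure_transcriptStateLaw (A : Adversary Q Y) (M : InteractiveSystem Q Y)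
    (t : ℕ) : IsProbabilityMeasure (transcriptStateLaw A M t) := by
  induction t with
  | zero =>
    unfold transcriptStateLaw
    exact Measure.isProbabilityMeasure_map (measurable_const.prodMk measurable_id).aemeasurable
  | succ t ih =>
    unfold transcriptStateLaw
    refine Measure.isProbabilityMeasure_map (Measurable.aemeasurable ?_)
    refine Measurable.prodMk ?_ measurable_snd.fst
    exact (measurable_snoc t).comp
      (measurable_fst.fst.fst.prodMk (measurable_fst.snd.prodMk measurable_snd.snd))

instance isProbabilityMeasure_transcriptLaw (A : Adversary Q Y) (M : InteractiveSystem Q Y)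
    (T : ℕ) : IsProbabilityMeasure (transcriptLaw A M T) :=
  Measure.isProbabilityMeasure_map measurable_fst.aemeasurable

/-- `(ε, δ)`-indistinguishability of two interactive systems. -/
def Indistinguishable (ε δ : ℝ) (M₀ M₁ : InteractiveSystem Q Y) : Prop :=
  ∀ (A : Adversary Q Y) (T : ℕ) (S : Set (Fin T → Q × Y)), MeasurableSet S →
    transcriptLaw A M₀ T S ≤
        ENNReal.ofReal (Real.exp ε) * transcriptLaw A M₁ T S + ENNReal.ofReal δ ∧
      transcriptLaw A M₁ T S ≤
        ENNReal.ofReal (Real.exp ε) * transcriptLaw A M₀ T S + ENNReal.ofReal δ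

/-- `(ε, δ)`-differential privacy of an interactive mechanism, that is, of a family `M` of
interactive systems indexed by the data sets, with respect to the relation `Nbr` of being
neighboring data sets. -/
def IsDP {D : Type*} (Nbr : D → D → Prop) (ε δ : ℝ) (M : D → InteractiveSystem Q Y) : Prop :=
  ∀ d d' : D, Nbr d d' → Indistinguishable ε δ (M d) (M d')

end Transcript

/-! ### The private Guess-and-Check algorithm -/

/-- A query: a real function of the data set that is `1`-Lipschitz, i.e. that changes by at most `1`
between neighboring data sets, and a guess for its value. -/
structure GuessQuery {D : Type*} (Nbr : D → D → Prop) where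
  f : D → ℝ
  lipschitz : ∀ d d' : D, Nbr d d' → |f d - f d'| ≤ 1
  guess : ℝ

/-- The σ-algebra generated by the evaluations `q ↦ q.f d` and by the guess. -/
instance {D : Type*} (Nbr : D → D → Prop) : MeasurableSpace (GuessQuery Nbr) :=
  MeasurableSpace.comap (fun q => (q.f, q.guess)) inferInstance

/-- A response: `PASS`, or `(WRONG, v)`, or no answer because the algorithm has halted. -/
inductive GuessResponse where
  | pass : GuessResponse
  | wrong (v : ℝ) : GuessResponse
  | halted : GuessResponse

/-- The responses as a disjoint union of `ℝ` and two points. -/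
def GuessResponse.toSum : GuessResponse → ℝ ⊕ Bool
  | .pass => Sum.inr true
  | .wrong v => Sum.inl v
  | .halted => Sum.inr false

instance : MeasurableSpace GuessResponse := MeasurableSpace.comap GuessResponse.toSum inferInstance

/-- One pass of the loop on the data set `d`. The memory is `s = (ρ, t)`: the threshold noise and
the number of `WRONG` answers so far. The fresh noises are `z = (γ, η)`: the one of the test and the
one of the released value. -/
noncomputable def guessCheckRound {D : Type*} {Nbr : D → D → Prop} (E : ℝ) (c : ℕ) (d : D)
    (s : ℝ × ℕ) (q : GuessQuery Nbr) (z : ℝ × ℝ) : (ℝ × ℕ) × GuessResponse :=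
  open Classical in
  if s.2 < c then
    if |q.f d - q.guess| + z.1 ≥ E + s.1 then
      ((s.1, s.2 + 1), GuessResponse.wrong (q.f d + z.2))
    else (s, GuessResponse.pass)
  else (s, GuessResponse.halted)

section Measurability

variable {D : Type*} {Nbr : D → D → Prop}

theorem GuessQuery.measurable_eval (d : D) : Measurable fun q : GuessQuery Nbr => q.f d :=
  ((measurable_pi_apply d).comp measurable_fst).comp
    (comap_measurable fun q : GuessQuery Nbr => (q.f, q.guess))

theorem GuessQuery.measurable_guess : Measurable fun q : GuessQuery Nbr => q.guess :=
  measurable_snd.comp (comap_measurable fun q : GuessQuery Nbr => (q.f, q.guess))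

theorem GuessResponse.measurable_wrong : Measurable GuessResponse.wrong :=
  measurable_comap_iff.2 measurable_inl

theorem measurable_guessCheckRound (E : ℝ) (c : ℕ) (d : D) :
    Measurable fun p : ((ℝ × ℕ) × GuessQuery Nbr) × (ℝ × ℝ) =>
      guessCheckRound E c d p.1.1 p.1.2 p.2 := by
  have hf : Measurable fun p : ((ℝ × ℕ) × GuessQuery Nbr) × (ℝ × ℝ) => p.1.2.f d :=
    (GuessQuery.measurable_eval d).comp measurable_fst.snd
  have hg : Measurable fun p : ((ℝ × ℕ) × GuessQuery Nbr) × (ℝ × ℝ) => p.1.2.guess :=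
    GuessQuery.measurable_guess.comp measurable_fst.snd
  unfold guessCheckRound
  refine Measurable.ite ?_ (Measurable.ite ?_ ?_ ?_) ?_
  · exact measurableSet_lt (by fun_prop) measurable_const
  · exact measurableSet_le (by fun_prop)
      ((continuous_abs.measurable.comp (hf.sub hg)).add measurable_snd.fst)
  · exact Measurable.prodMk (by fun_prop)
      (GuessResponse.measurable_wrong.comp (hf.add measurable_snd.snd))
  · exact measurable_fst.fst.prodMk measurable_const
  · exact measurable_fst.fst.prodMk measurable_const

end Measurability

/-- The private Guess-and-Check algorithm with error tolerance `E` and privacy parameters `c`, `ε`,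
run on the data set `d`. The threshold noise `ρ ∼ Lap(1/ε)` is drawn once and for all at the start;
every round uses fresh independent noises `γ, η ∼ Lap(c/ε)`. -/
noncomputable def guessAndCheck {D : Type*} (Nbr : D → D → Prop) (E : ℝ) (c : ℕ) (ε : ℝ) (d : D) :
    InteractiveSystem (GuessQuery Nbr) GuessResponse where
  State := ℝ × ℕ
  start := (laplace (1 / ε)).map fun ρ => (ρ, 0)
  isProbabilityMeasure_start :=
    Measure.isProbabilityMeasure_map (measurable_id.prodMk measurable_const).aemeasurable
  step :=
    (Kernel.id ×ₖ Kernel.const ((ℝ × ℕ) × GuessQuery Nbr)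
      ((laplace (c / ε)).prod (laplace (c / ε)))).map
      fun p => guessCheckRound E c d p.1.1 p.1.2 p.2
  isMarkovKernel_step := Kernel.IsMarkovKernel.map _ (measurable_guessCheckRound E c d)

open scoped ENNReal

/-! ### Shifting Laplace noise -/

/-! Compare the run on `d` with threshold noise `ρ` to the run on `d'` with threshold noise `ρ + 1`.
The tested distance changes by at most 1 between `d` and `d'`, so with the same `γ` every PASS on
`d` is a PASS on `d'`: passes cost nothing, however many there are. For a WRONG, the cutoff for `γ`
rises by at most 2 and the released value moves by at most 1, which costs `exp (2ε/c)` and `exp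
(ε/c)`. There are at most `c` such rounds, so together they cost `exp (3ε)`; shifting `ρ` by 1 costs
`exp ε`.

The adaptive interaction is handled by a weighted simulation, `mul_transcriptLaw_le`: each WRONG
discounts the state by `exp (-3ε/c)`, so that one step on `d` is dominated by one step on `d'`
without loss (`lintegral_guessAndCheck_step_le`). The total discount is paid back once, at the end.
-/

theorem laplace_of_pos {b : ℝ} (hb : 0 < b) : laplace b = volume.withDensity (laplacePDF b) := by
  unfold laplace
  rw [if_pos hb]

theorem measurable_laplacePDF (b : ℝ) : Measurable (laplacePDF b) := by
  unfold laplacePDF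
  fun_prop

theorem laplacePDF_sub_le {b k r : ℝ} (hb : 0 < b) (hk : |k| ≤ r) (x : ℝ) :
    laplacePDF b (x - k) ≤ ENNReal.ofReal (Real.exp (r / b)) * laplacePDF b x := by
  unfold laplacePDF
  rw [← ENNReal.ofReal_mul (Real.exp_pos _).le]
  refine ENNReal.ofReal_le_ofReal ?_
  have h : Real.exp (-|x - k| / b) ≤ Real.exp (r / b) * Real.exp (-|x| / b) := by
    rw [← Real.exp_add, ← add_div]
    refine Real.exp_le_exp.2 (div_le_div_of_nonneg_right ?_ hb.le)
    linarith [abs_sub_abs_le_abs_sub x k]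
  calc 1 / (2 * b) * Real.exp (-|x - k| / b)
      ≤ 1 / (2 * b) * (Real.exp (r / b) * Real.exp (-|x| / b)) := by gcongr
    _ = _ := by ring

theorem lintegral_laplace_add_le {b k r : ℝ} (hb : 0 < b) (hk : |k| ≤ r) {g : ℝ → ℝ≥0∞}
    (hg : Measurable g) :
    ∫⁻ x, g (x + k) ∂laplace b ≤
      ENNReal.ofReal (Real.exp (r / b)) * ∫⁻ x, g x ∂laplace b := by
  have hp := measurable_laplacePDF b
  have hgk : Measurable fun x => g (x + k) := hg.comp (measurable_add_const k)
  rw [laplace_of_pos hb, lintegral_withDensity_eq_lintegral_mul _ hp hgk,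
    lintegral_withDensity_eq_lintegral_mul _ hp hg,
    ← lintegral_const_mul _ (hp.mul hg),
    ← lintegral_sub_right_eq_self _ k]
  refine lintegral_mono fun x => ?_
  simp only [Pi.mul_apply, sub_add_cancel]
  rw [← mul_assoc]
  gcongr
  exact laplacePDF_sub_le hb hk x

/-- Translation by `r` maps `Ici x` into `Ici y`. No lower bound on `y` is needed, since lowering it
only enlarges the half-line. -/
theorem laplace_Ici_le {b x y r : ℝ} (hb : 0 < b) (hr : 0 ≤ r) (hxy : y ≤ x + r) :
    laplace b (Set.Ici x) ≤
      ENNReal.ofReal (Real.exp (r / b)) * laplace b (Set.Ici y) := by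
  have h := lintegral_laplace_add_le hb (abs_of_nonneg hr).le
    (measurable_one.indicator (measurableSet_Ici (a := y)) : Measurable
      ((Set.Ici y).indicator (1 : ℝ → ℝ≥0∞)))
  rw [lintegral_indicator_one measurableSet_Ici] at h
  refine le_trans ?_ h
  rw [← lintegral_indicator_one measurableSet_Ici]
  refine lintegral_mono fun z => ?_
  refine Set.indicator_apply_le' (fun hz => ?_) (fun _ => zero_le)
  have : z + r ∈ Set.Ici y := by
    have : x ≤ z := hz
    exact hxy.trans (by linarith)
  rw [Set.indicator_of_mem this]
  rfl

/-! ### Simulating one interactive system by another -/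

section Simulation

variable {Q Y : Type*} [MeasurableSpace Q] [MeasurableSpace Y]

theorem measurable_transcriptStateLaw_update (S : Type*) [MeasurableSpace S] (t : ℕ) :
    Measurable fun p : (((Fin t → Q × Y) × S) × Q) × (S × Y) =>
      ((Fin.snoc (α := fun _ => Q × Y) p.1.1.1 (p.1.2, p.2.2), p.2.1) :
        (Fin (t + 1) → Q × Y) × S) :=
  Measurable.prodMk
    ((measurable_snoc t).comp
      (measurable_fst.fst.fst.prodMk (measurable_fst.snd.prodMk measurable_snd.snd)))
    measurable_snd.fst

theorem lintegral_transcriptStateLaw_succ (A : Adversary Q Y) (M : InteractiveSystem Q Y) (t : ℕ)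
    {F : (Fin (t + 1) → Q × Y) × M.State → ℝ≥0∞} (hF : Measurable F) :
    ∫⁻ p, F p ∂transcriptStateLaw A M (t + 1) =
      ∫⁻ p, ∫⁻ q, ∫⁻ r, F (Fin.snoc (α := fun _ => Q × Y) p.1 (q, r.2), r.1)
        ∂M.step (p.2, q) ∂A.next t p.1 ∂transcriptStateLaw A M t := by
  have hm := measurable_transcriptStateLaw_update (Q := Q) (Y := Y) M.State t
  have hFm : Measurable fun p : (((Fin t → Q × Y) × M.State) × Q) × (M.State × Y) =>
      F (Fin.snoc (α := fun _ => Q × Y) p.1.1.1 (p.1.2, p.2.2), p.2.1) := hF.comp hm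
  rw [transcriptStateLaw, lintegral_map hF hm, Measure.lintegral_compProd hFm,
    Measure.lintegral_compProd]
  · rfl
  · exact hFm.lintegral_kernel_prod_right'

/-- If the memory of `M` can be translated by `φ` into that of `N` such that the start and every
step of `M`, weighted by `u`, are dominated by those of `N`, then so are the transcripts. -/
theorem lintegral_transcriptStateLaw_le (A : Adversary Q Y) {M N : InteractiveSystem Q Y}
    {φ : M.State → N.State} (hφ : Measurable φ) {u : M.State → ℝ≥0∞} (hu : Measurable u) (C : ℝ≥0∞)
    (hstart : ∀ F : N.State → ℝ≥0∞, Measurable F →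
      ∫⁻ s, u s * F (φ s) ∂M.start ≤ C * ∫⁻ s, F s ∂N.start)
    (hstep : ∀ (s : M.State) (q : Q) (F : N.State × Y → ℝ≥0∞), Measurable F →
      ∫⁻ r, u r.1 * F (φ r.1, r.2) ∂M.step (s, q) ≤ u s * ∫⁻ r, F r ∂N.step (φ s, q))
    (t : ℕ) (F : (Fin t → Q × Y) × N.State → ℝ≥0∞) (hF : Measurable F) :
    ∫⁻ p, u p.2 * F (p.1, φ p.2) ∂transcriptStateLaw A M t ≤
      C * ∫⁻ p, F p ∂transcriptStateLaw A N t := by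
  have huF : Measurable fun p : (Fin t → Q × Y) × M.State => u p.2 * F (p.1, φ p.2) :=
    (hu.comp measurable_snd).mul (hF.comp (measurable_fst.prodMk (hφ.comp measurable_snd)))
  induction t with
  | zero =>
    have hm : ∀ K : InteractiveSystem Q Y, Measurable fun s : K.State =>
        ((Fin.elim0, s) : (Fin 0 → Q × Y) × K.State) := fun K =>
      measurable_const.prodMk measurable_id
    rw [transcriptStateLaw, transcriptStateLaw, lintegral_map huF (hm M), lintegral_map hF (hm N)]
    exact hstart (fun s => F (Fin.elim0, s)) (hF.comp (measurable_const.prodMk measurable_id))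
  | succ t ih =>
    have hm := measurable_transcriptStateLaw_update (Q := Q) (Y := Y) N.State t
    rw [lintegral_transcriptStateLaw_succ A M t huF, lintegral_transcriptStateLaw_succ A N t hF]
    -- The last round of `M` is exchanged for one of `N` by `hstep`. Averaging `F` over that round
    -- of `N` gives the test function to which the induction hypothesis applies. The query law
    -- depends on the transcript alone, so it is the same for both systems.
    have hG : Measurable fun x : ((Fin t → Q × Y) × N.State) × Q =>
        ∫⁻ r, F (Fin.snoc (α := fun _ => Q × Y) x.1.1 (x.2, r.2), r.1)
          ∂N.step (x.1.2, x.2) :=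
      Measurable.lintegral_kernel_prod_right'
        (κ := N.step.comap (fun p : ((Fin t → Q × Y) × N.State) × Q => (p.1.2, p.2))
          (measurable_fst.snd.prodMk measurable_snd)) (hF.comp hm)
    have hH : Measurable fun p : (Fin t → Q × Y) × N.State =>
        ∫⁻ q, ∫⁻ r, F (Fin.snoc (α := fun _ => Q × Y) p.1 (q, r.2), r.1)
          ∂N.step (p.2, q) ∂A.next t p.1 :=
      Measurable.lintegral_kernel_prod_right'
        (κ := (A.next t).comap (Prod.fst : (Fin t → Q × Y) × N.State → _) measurable_fst) hG
    refine le_trans (lintegral_mono fun p => ?_) (ih _ hH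
      ((hu.comp measurable_snd).mul (hH.comp (measurable_fst.prodMk (hφ.comp measurable_snd)))))
    have hGp := hG.comp (measurable_prodMk_left (x := (p.1, φ p.2)))
    refine le_trans (lintegral_mono fun q => ?_) (lintegral_const_mul _ hGp).le
    exact hstep p.2 q (fun r => F (Fin.snoc (α := fun _ => Q × Y) p.1 (q, r.2), r.1))
      (hF.comp (hm.comp (measurable_prodMk_left (x := ((p.1, φ p.2), q)))))

/-- Test functions that ignore the memory remove `φ`, and a uniform lower bound on the weight
removes `u`. -/
theorem mul_transcriptLaw_le (A : Adversary Q Y) {M N : InteractiveSystem Q Y}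
    {φ : M.State → N.State} (hφ : Measurable φ) {u : M.State → ℝ≥0∞} (hu : Measurable u)
    (C : ℝ≥0∞)
    (hstart : ∀ F : N.State → ℝ≥0∞, Measurable F →
      ∫⁻ s, u s * F (φ s) ∂M.start ≤ C * ∫⁻ s, F s ∂N.start)
    (hstep : ∀ (s : M.State) (q : Q) (F : N.State × Y → ℝ≥0∞), Measurable F →
      ∫⁻ r, u r.1 * F (φ r.1, r.2) ∂M.step (s, q) ≤ u s * ∫⁻ r, F r ∂N.step (φ s, q))
    {b : ℝ≥0∞} (hb : ∀ s, b ≤ u s) (T : ℕ) {S : Set (Fin T → Q × Y)} (hS : MeasurableSet S) :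
    b * transcriptLaw A M T S ≤ C * transcriptLaw A N T S := by
  have hI : Measurable (S.indicator (1 : (Fin T → Q × Y) → ℝ≥0∞)) := measurable_one.indicator hS
  have hI' : Measurable fun p : (Fin T → Q × Y) × M.State =>
      S.indicator (1 : (Fin T → Q × Y) → ℝ≥0∞) p.1 := hI.comp measurable_fst
  have h := lintegral_transcriptStateLaw_le A hφ hu C hstart hstep T
    (fun p => S.indicator 1 p.1) (hI.comp measurable_fst)
  rw [transcriptLaw, transcriptLaw, ← lintegral_indicator_one hS, ← lintegral_indicator_one hS,
    lintegral_map hI measurable_fst, lintegral_map hI measurable_fst,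
    ← lintegral_const_mul b hI']
  exact le_trans (lintegral_mono fun p => mul_le_mul_left (hb p.2) _) h

end Simulation

/-! ### Privacy of Guess-and-Check -/

section GuessAndCheck

variable {D : Type*} {Nbr : D → D → Prop}

theorem lintegral_guessAndCheck_step (E : ℝ) (c : ℕ) (ε : ℝ) (d : D) (s : ℝ × ℕ)
    (q : GuessQuery Nbr) {G : (ℝ × ℕ) × GuessResponse → ℝ≥0∞} (hG : Measurable G) :
    ∫⁻ r, G r ∂(guessAndCheck Nbr E c ε d).step (s, q) =
      ∫⁻ z, G (guessCheckRound E c d s q z)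
        ∂(laplace (c / ε)).prod (laplace (c / ε)) := by
  have hm := measurable_guessCheckRound (Nbr := Nbr) E c d
  have hGm : Measurable fun p : ((ℝ × ℕ) × GuessQuery Nbr) × (ℝ × ℝ) =>
      G (guessCheckRound E c d p.1.1 p.1.2 p.2) := hG.comp hm
  change ∫⁻ r, G r ∂((Kernel.id ×ₖ Kernel.const ((ℝ × ℕ) × GuessQuery Nbr)
      ((laplace (c / ε)).prod (laplace (c / ε)))).map
      fun p => guessCheckRound E c d p.1.1 p.1.2 p.2) (s, q) = _
  rw [Kernel.map_apply _ hm, lintegral_map hG hm, Kernel.prod_apply, Kernel.id_apply,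
    Kernel.const_apply, Measure.dirac_prod, lintegral_map hGm measurable_prodMk_left]

/-- The noise `γ` matters only through the side of the cutoff on which it falls, and `η` is
independent of it, so the WRONG term factors. -/
theorem lintegral_guessAndCheck_step_of_lt (E : ℝ) {c : ℕ} (ε : ℝ) (d : D) (ρ : ℝ) {t : ℕ}
    (ht : t < c) (q : GuessQuery Nbr) {G : (ℝ × ℕ) × GuessResponse → ℝ≥0∞} (hG : Measurable G) :
    ∫⁻ r, G r ∂(guessAndCheck Nbr E c ε d).step ((ρ, t), q) =
      laplace (c / ε) (Set.Ici (E + ρ - |q.f d - q.guess|)) *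
          (∫⁻ η, G ((ρ, t + 1), GuessResponse.wrong (q.f d + η)) ∂laplace (c / ε)) +
        laplace (c / ε) (Set.Iio (E + ρ - |q.f d - q.guess|)) *
          G ((ρ, t), GuessResponse.pass) := by
  have hm : Measurable fun z : ℝ × ℝ => G (guessCheckRound E c d (ρ, t) q z) :=
    hG.comp ((measurable_guessCheckRound E c d).comp
      (measurable_prodMk_left (x := (((ρ, t) : ℝ × ℕ), q))))
  rw [lintegral_guessAndCheck_step E c ε d (ρ, t) q hG, lintegral_prod _ hm.aemeasurable]
  rw [← lintegral_add_compl _ (measurableSet_Ici (a := E + ρ - |q.f d - q.guess|)), Set.compl_Ici]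
  congr 1
  · rw [mul_comm, ← setLIntegral_const]
    refine setLIntegral_congr_fun measurableSet_Ici fun γ hγ => ?_
    have hγ' : |q.f d - q.guess| + γ ≥ E + ρ := by
      have : E + ρ - |q.f d - q.guess| ≤ γ := hγ
      linarith
    simp only [guessCheckRound, if_pos ht, if_pos hγ']
  · rw [mul_comm, ← setLIntegral_const]
    refine setLIntegral_congr_fun measurableSet_Iio fun γ hγ => ?_
    have hγ' : ¬ |q.f d - q.guess| + γ ≥ E + ρ := by
      have : γ < E + ρ - |q.f d - q.guess| := hγ
      linarith
    simp only [guessCheckRound, if_pos ht, if_neg hγ']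
    simp

theorem lintegral_guessAndCheck_step_of_le (E : ℝ) {c : ℕ} (ε : ℝ) (d : D) (ρ : ℝ) {t : ℕ}
    (ht : c ≤ t) (q : GuessQuery Nbr) {G : (ℝ × ℕ) × GuessResponse → ℝ≥0∞} (hG : Measurable G) :
    ∫⁻ r, G r ∂(guessAndCheck Nbr E c ε d).step ((ρ, t), q) =
      G ((ρ, t), GuessResponse.halted) := by
  rw [lintegral_guessAndCheck_step E c ε d (ρ, t) q hG]
  simp only [guessCheckRound, if_neg ht.not_gt]
  simp

/-- The factor by which a state with `t` wrong answers is discounted. -/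
noncomputable def wrongDiscount (c : ℕ) (ε : ℝ) (t : ℕ) : ℝ≥0∞ :=
  ENNReal.ofReal (Real.exp (-(3 * ε / c))) ^ min t c

/-- Capping the exponent at `c` makes the bound hold for every counter value, so no invariant `t ≤
c` has to be carried along the run. -/
theorem le_wrongDiscount {c : ℕ} (hc : 1 ≤ c) {ε : ℝ} (hε : 0 < ε) (t : ℕ) :
    ENNReal.ofReal (Real.exp (-(3 * ε))) ≤ wrongDiscount c ε t := by
  have hc' : (0 : ℝ) < c := by exact_mod_cast hc
  unfold wrongDiscount
  rw [← ENNReal.ofReal_pow (Real.exp_pos _).le, ← Real.exp_nat_mul]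
  refine ENNReal.ofReal_le_ofReal (Real.exp_le_exp.2 ?_)
  have h1 : ((min t c : ℕ) : ℝ) ≤ c := by exact_mod_cast min_le_right t c
  have h2 : ((min t c : ℕ) : ℝ) * (3 * ε / c) ≤ c * (3 * ε / c) := by gcongr
  rw [mul_div_cancel₀ _ hc'.ne'] at h2
  linarith

theorem wrongDiscount_succ {c t : ℕ} (ht : t < c) (ε : ℝ) :
    wrongDiscount c ε (t + 1) =
      wrongDiscount c ε t * ENNReal.ofReal (Real.exp (-(3 * ε / c))) := by
  unfold wrongDiscount
  rw [min_eq_left ht.le, min_eq_left (Nat.succ_le_of_lt ht), pow_succ]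

theorem lintegral_guessAndCheck_start_le {c : ℕ} {ε : ℝ} (hε : 0 < ε) (E : ℝ) (d d' : D)
    {F : ℝ × ℕ → ℝ≥0∞} (hF : Measurable F) :
    ∫⁻ s, wrongDiscount c ε s.2 * F (s.1 + 1, s.2) ∂(guessAndCheck Nbr E c ε d).start ≤
      ENNReal.ofReal (Real.exp ε) * ∫⁻ s, F s ∂(guessAndCheck Nbr E c ε d').start := by
  have hm : Measurable fun ρ : ℝ => ((ρ, 0) : ℝ × ℕ) := measurable_id.prodMk measurable_const
  have hu : Measurable (wrongDiscount c ε) := measurable_from_top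
  change ∫⁻ s, wrongDiscount c ε s.2 * F (s.1 + 1, s.2) ∂(laplace (1 / ε)).map (fun ρ => (ρ, 0)) ≤
    ENNReal.ofReal (Real.exp ε) * ∫⁻ s, F s ∂(laplace (1 / ε)).map (fun ρ => (ρ, 0))
  rw [lintegral_map (by fun_prop) hm, lintegral_map hF hm]
  have h := lintegral_laplace_add_le (b := 1 / ε) (k := 1) (r := 1) (by positivity) (by simp)
    (hF.comp hm)
  -- The counter starts at 0, where the discount is 1.
  simpa [wrongDiscount] using h

theorem lintegral_guessAndCheck_step_le {c : ℕ} (hc : 1 ≤ c) {ε : ℝ} (hε : 0 < ε) (E : ℝ)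
    {d d' : D} (hd : ∀ q : GuessQuery Nbr, |q.f d - q.f d'| ≤ 1) (s : ℝ × ℕ) (q : GuessQuery Nbr)
    {F : (ℝ × ℕ) × GuessResponse → ℝ≥0∞} (hF : Measurable F) :
    ∫⁻ r, wrongDiscount c ε r.1.2 * F ((r.1.1 + 1, r.1.2), r.2)
        ∂(guessAndCheck Nbr E c ε d).step (s, q) ≤
      wrongDiscount c ε s.2 *
        ∫⁻ r, F r ∂(guessAndCheck Nbr E c ε d').step ((s.1 + 1, s.2), q) := by
  obtain ⟨ρ, t⟩ := s
  have hu : Measurable (wrongDiscount c ε) := measurable_from_top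
  have hG : Measurable fun r : (ℝ × ℕ) × GuessResponse =>
      wrongDiscount c ε r.1.2 * F ((r.1.1 + 1, r.1.2), r.2) := by fun_prop
  rcases lt_or_ge t c with ht | ht
  · have hb : (0 : ℝ) < c / ε := div_pos (by exact_mod_cast hc) hε
    have hcne : (c : ℝ) ≠ 0 := by positivity
    rw [lintegral_guessAndCheck_step_of_lt E ε d ρ ht q hG,
      lintegral_guessAndCheck_step_of_lt E ε d' (ρ + 1) ht q hF, mul_add]
    have hq := abs_le.1 ((abs_abs_sub_abs_le (q.f d - q.guess) (q.f d' - q.guess)).trans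
      (by simpa using hd q))
    have hW : ∀ v : ℝ, Measurable fun η : ℝ =>
        F ((ρ + 1, t + 1), GuessResponse.wrong (v + η)) := fun v =>
      hF.comp (measurable_const.prodMk
        (GuessResponse.measurable_wrong.comp (measurable_const_add v)))
    have hanswer := lintegral_laplace_add_le hb (hd q) (hW (q.f d'))
    simp only [show ∀ η, q.f d' + (η + (q.f d - q.f d')) = q.f d + η from fun η => by ring]
      at hanswer
    -- The 2 is 1 from the raised threshold plus 1 from the change of the tested distance.
    have htest := laplace_Ici_le (b := c / ε) (x := E + ρ - |q.f d - q.guess|)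
      (y := E + (ρ + 1) - |q.f d' - q.guess|) (r := 2) hb (by norm_num) (by linarith [hq.2])
    -- The discount for one WRONG exactly cancels the costs of the test and of the released value.
    have hexp : ENNReal.ofReal (Real.exp (-(3 * ε / c))) *
        (ENNReal.ofReal (Real.exp (2 / (c / ε))) * ENNReal.ofReal (Real.exp (1 / (c / ε)))) =
        1 := by
      rw [← ENNReal.ofReal_mul (Real.exp_pos _).le, ← ENNReal.ofReal_mul (Real.exp_pos _).le,
        ← Real.exp_add, ← Real.exp_add,
        show -(3 * ε / c) + (2 / (c / ε) + 1 / (c / ε)) = 0 by field_simp; ring,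
        Real.exp_zero, ENNReal.ofReal_one]
    refine add_le_add ?_ ?_
    · dsimp only
      rw [lintegral_const_mul _ (hW _), wrongDiscount_succ ht]
      calc _ ≤ (ENNReal.ofReal (Real.exp (2 / (c / ε))) *
              laplace (c / ε) (Set.Ici (E + (ρ + 1) - |q.f d' - q.guess|))) *
            (wrongDiscount c ε t * ENNReal.ofReal (Real.exp (-(3 * ε / c))) *
              (ENNReal.ofReal (Real.exp (1 / (c / ε))) *
                ∫⁻ η, F ((ρ + 1, t + 1), GuessResponse.wrong (q.f d' + η))
                  ∂laplace (c / ε))) := by gcongr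
        _ = (ENNReal.ofReal (Real.exp (-(3 * ε / c))) *
              (ENNReal.ofReal (Real.exp (2 / (c / ε))) *
                ENNReal.ofReal (Real.exp (1 / (c / ε))))) *
            (wrongDiscount c ε t *
              (laplace (c / ε) (Set.Ici (E + (ρ + 1) - |q.f d' - q.guess|)) *
                ∫⁻ η, F ((ρ + 1, t + 1), GuessResponse.wrong (q.f d' + η))
                  ∂laplace (c / ε))) := by ring
        _ = _ := by rw [hexp, one_mul]
    -- PASS: the cutoff on `d'` is at least the one on `d`, because the raise by 1 absorbs the
    -- change of the distance; monotonicity suffices.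
    · rw [mul_left_comm]
      refine mul_le_mul_right (mul_le_mul_left (measure_mono (Set.Iio_subset_Iio ?_)) _) _
      linarith [hq.1]
  · rw [lintegral_guessAndCheck_step_of_le E ε d ρ ht q hG,
      lintegral_guessAndCheck_step_of_le E ε d' (ρ + 1) ht q hF]

theorem transcriptLaw_guessAndCheck_le {c : ℕ} (hc : 1 ≤ c) {ε : ℝ} (hε : 0 < ε) (E : ℝ)
    {d d' : D} (hd : ∀ q : GuessQuery Nbr, |q.f d - q.f d'| ≤ 1)
    (A : Adversary (GuessQuery Nbr) GuessResponse) (T : ℕ)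
    {S : Set (Fin T → GuessQuery Nbr × GuessResponse)} (hS : MeasurableSet S) :
    transcriptLaw A (guessAndCheck Nbr E c ε d) T S ≤
      ENNReal.ofReal (Real.exp (4 * ε)) * transcriptLaw A (guessAndCheck Nbr E c ε d') T S := by
  have hφ : Measurable fun s : ℝ × ℕ => (s.1 + 1, s.2) := by fun_prop
  have hu : Measurable fun s : ℝ × ℕ => wrongDiscount c ε s.2 :=
    (measurable_from_top (f := wrongDiscount c ε)).comp measurable_snd
  have h := mul_transcriptLaw_le A (M := guessAndCheck Nbr E c ε d)
    (N := guessAndCheck Nbr E c ε d') hφ hu (ENNReal.ofReal (Real.exp ε))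
    (fun F hF => lintegral_guessAndCheck_start_le hε E d d' hF)
    (fun s q F hF => lintegral_guessAndCheck_step_le hc hε E hd s q hF)
    (fun s => le_wrongDiscount hc hε s.2) T hS
  -- Multiplying by `exp (3ε)` undoes the smallest possible discount.
  have h' := mul_le_mul_right h (ENNReal.ofReal (Real.exp (3 * ε)))
  rw [← mul_assoc, ← mul_assoc, ← ENNReal.ofReal_mul (Real.exp_pos _).le,
    ← ENNReal.ofReal_mul (Real.exp_pos _).le, ← Real.exp_add, ← Real.exp_add, add_neg_cancel,
    Real.exp_zero, ENNReal.ofReal_one, one_mul, show 3 * ε + ε = 4 * ε by ring] at h'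
  exact h'

end GuessAndCheck

theorem mainTheorem6 {D : Type*} (Nbr : D → D → Prop) (E : ℝ) (hE : 0 < E)
    (c : ℕ) (hc : 1 ≤ c) (ε : ℝ) (hε : 0 < ε) (hε' : ε < 1) :
    IsDP Nbr (4 * ε) 0 (guessAndCheck Nbr E c ε) := by
  intro d d' hdd' A T S hS
  rw [ENNReal.ofReal_zero, add_zero, add_zero]
  exact ⟨transcriptLaw_guessAndCheck_le hc hε E (fun q => q.lipschitz d d' hdd') A T hS,
    transcriptLaw_guessAndCheck_le hc hε E
      (fun q => by rw [abs_sub_comm]; exact q.lipschitz d d' hdd') A T hS⟩
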